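/- Let $d\ge 1$, let $q\ge 0$ and $\tau$ be real numbers with $\tau\ge q+2>d/2$, and let $\Omega\subset\mathbb R^d$ be a bounded domain (non-empty, open, connected) with boundary $\partial\Omega$ of class $C^{q+2}$. Consider the boundary value problem $$Lu:=-\sum_{i,j=1}^d a_{ij}\frac{\partial^2u}{\partial x^i\partial x^j}+\sum_{i=1}^d b_i\frac{\partial u}{\partial x^i}+cu=f\ \text{ in }\Omega,\qquad u=g\ \text{ on }\partial\Omega,$$ with real coefficients $a_{ij},b_i,c\in C^q(\overline\Omega)$, where $L$ is uniformly elliptic, i.e. for some constant $C>0$, $C^{-1}\|\xi\|^2\le|\sum_{i,j}a_{ij}(x)\xi_i\xi_j|\le C\|\xi\|^2$ for all $x\in\overline\Omega$, $\xi\in\mathbb R^d$. (For non-integer $r$, $C^r$ denotes the Hölder class. Derivatives are weak derivatives, and the boundary condition is understood in the sense of traces.) Let the data $f,g$ be such that this problem has exactly one solution $u$ in $H^{q+2}(\Omega)$. Let $\Phi:\mathbb R^d\to\mathbb R$ be a continuous integrable kernel whose Fourier transform $\widehat\Phi(w)=(2\pi)^{-d/2}\int_{\mathbb R^d}\Phi(x)e^{-iw^Tx}\,dx$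 is real and satisfies $C_1(1+\|w\|^2)^{-\tau}\le\widehat\Phi(w)\le C_2(1+\|w\|^2)^{-\tau}$ for all $w\in\mathbb R^d$, with constants $C_1,C_2>0$. Let $X=\{x_1,\dots,x_N\}\subset\Omega$ be a finite non-empty set of distinct points, let $V_{\Phi,X}=\mathrm{span}\{\Phi(\cdot-x_j):1\le j\le N\}$, and let $h=\sup_{x\in\Omega}\min_{1\le j\le N}\|x-x_j\|$. Put $$J^h(v;f,g)=\tfrac12\Big(\|Lv-f\|_{L^2(\Omega)}^2+h^{-3}\|v-g\|_{L^2(\partial\Omega)}^2\Big),$$ $$Q^h(v,w)=(Lv,Lw)_{L^2(\Omega)}+h^{-3}(v,w)_{L^2(\partial\Omega)},\qquad |||v|||=\sqrt{Q^h(v,v)}.$$ Then $V_{\Phi,X}\subset H^\tau(\Omega)$ and, for every $w\in H^{q+2}(\Omega)$, $Lw\in L^2(\Omega)$ and the trace of $w$ belongs to $L^2(\partial\Omega)$, so that these quantities are well defined. The functional $J^h(\,\cdot\,;f,g)$ has a unique minimizer $u^h$ over $V_{\Phi,X}$. This $u^h$ is the orthogonal projection of $u$ onto $V_{\Phi,X}$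 with respect to the discrete energy norm: $Q^h(u-u^h,v^h)=0$ for all $v^h\in V_{\Phi,X}$, and $$|||u-u^h|||=\inf_{v^h\in V_{\Phi,X}}|||u-v^h|||.$$ -/

import Mathlib

open MeasureTheory

noncomputable section

namespace LeastSquaresRBF

/-- Euclidean space `ℝ^d`. -/
abbrev E (d : ℕ) : Type := EuclideanSpace ℝ (Fin d)

/-- The `i`-th coordinate direction. -/
def dir {d : ℕ} (i : Fin d) : E d := EuclideanSpace.single i (1 : ℝ)

/-! ### Regularity classes -/

/-- `γ ∈ C^r(closure U)` for a real number `r ≥ 0` and an open set `U`: with `m = ⌊r⌋`, the function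
is `C^m` on `U`, its derivatives up to order `m` extend continuously to `closure U`, and the
derivatives of order `m` are Hölder continuous on `U` with exponent `r - m`.
(For integer `r` and bounded `U` the last clause is implied by the others: a bound on the
`m`-th derivative.) Values of `γ` outside `U` are irrelevant. -/
def HolderClass {d : ℕ} (r : ℝ) (U : Set (E d)) (γ : E d → ℝ) : Prop :=
  ContDiffOn ℝ (⌊r⌋₊ : ℕ) γ U ∧
  (∀ k : ℕ, k ≤ ⌊r⌋₊ → ∃ G : E d → ContinuousMultilinearMap ℝ (fun _ : Fin k => E d) ℝ,
    ContinuousOn G (closure U) ∧ Set.EqOn (iteratedFDeriv ℝ k γ) G U) ∧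
  ∃ C : NNReal, HolderOnWith C (Real.toNNReal (r - ⌊r⌋₊)) (iteratedFDeriv ℝ ⌊r⌋₊ γ) U

/-- `∂Ω ∈ C^r`: near each boundary point, after a linear isometric change of coordinates
`ℝ^d ≃ ℝ^(d-1) × ℝ`, the set `Ω` is the strict epigraph of a `C^r` function of `d - 1` variables. -/
def BoundaryOfClass {d : ℕ} (r : ℝ) (Ω : Set (E d)) : Prop :=
  ∀ p ∈ frontier Ω, ∃ ε : ℝ, 0 < ε ∧ ∃ ψ : E d ≃ₗᵢ[ℝ] WithLp 2 (E (d - 1) × ℝ),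
    ∃ γ : E (d - 1) → ℝ, HolderClass r (Metric.ball (ψ p).fst ε) γ ∧
      ∀ x ∈ Metric.ball p ε, x ∈ Ω ↔ γ (ψ x).fst < (ψ x).snd

/-! ### Sobolev spaces, weak derivatives and boundary values -/

/-- `f ∈ H^s(Ω)`: on `Ω`, the function `f` agrees almost everywhere with a member of the
(Bessel potential) Sobolev space `H^s(ℝ^d)`. -/
def MemSobolevOn {d : ℕ} (s : ℝ) (Ω : Set (E d)) (f : E d → ℝ) : Prop :=
  ∃ F : Lp ℂ 2 (volume : Measure (E d)),
    TemperedDistribution.MemSobolev s 2 (Lp.toTemperedDistribution F) ∧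
    ∀ᵐ x ∂(volume.restrict Ω), F x = (f x : ℂ)

/-- `g` is the weak partial derivative of `f` in the `i`-th direction on the open set `Ω`. -/
def HasWeakPartial {d : ℕ} (Ω : Set (E d)) (i : Fin d) (f g : E d → ℝ) : Prop :=
  LocallyIntegrableOn f Ω ∧ LocallyIntegrableOn g Ω ∧
  ∀ φ : E d → ℝ, ContDiff ℝ (⊤ : ℕ∞) φ → HasCompactSupport φ → tsupport φ ⊆ Ω →
    ∫ x in Ω, f x * fderiv ℝ φ x (dir i) = - ∫ x in Ω, g x * φ x

open Classical in
/-- The weak partial derivative `∂f/∂x^i` on `Ω` (unique up to a null set where it exists; zero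
if there is none). -/
def weakPartial {d : ℕ} (Ω : Set (E d)) (i : Fin d) (f : E d → ℝ) : E d → ℝ :=
  if h : ∃ g, HasWeakPartial Ω i f g then h.choose else 0

open Classical in
/-- The boundary values of (the class of) `f`: the values of the representative of `f` which is
continuous on `closure Ω`. That representative is unique, and it exists for `f ∈ H^s(Ω)` with
`s > d / 2`, where its restriction to `∂Ω` is the trace of `f`. -/
def trace {d : ℕ} (Ω : Set (E d)) (f : E d → ℝ) : E d → ℝ :=
  if h : ∃ G : E d → ℝ, ContinuousOn G (closure Ω) ∧ f =ᵐ[volume.restrict Ω] G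
  then h.choose else 0

/-- The surface measure on `∂Ω`: the normalized `(d-1)`-dimensional Hausdorff measure. -/
def surfaceMeasure {d : ℕ} (Ω : Set (E d)) : Measure (E d) :=
  (Measure.euclideanHausdorffMeasure (d - 1) : Measure (E d)).restrict (frontier Ω)

/-! ### The boundary value problem -/

/-- The coefficients of `L u = - ∑ a_ij ∂²u/∂x^i∂x^j + ∑ b_i ∂u/∂x^i + c u`. -/
structure Operator (d : ℕ) where
  a : Fin d → Fin d → E d → ℝ
  b : Fin d → E d → ℝ
  c : E d → ℝ

/-- `L u` on `Ω`, with weak derivatives. -/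
def Operator.apply {d : ℕ} (L : Operator d) (Ω : Set (E d)) (u : E d → ℝ) : E d → ℝ := fun x =>
  - (∑ i, ∑ j, L.a i j x * weakPartial Ω i (weakPartial Ω j u) x)
    + ∑ i, L.b i x * weakPartial Ω i u x + L.c x * u x

/-- Uniform ellipticity of order `2`. For coefficients which are continuous up to the boundary it
amounts to the same to let `x` range over `closure Ω`. -/
def Operator.UniformlyElliptic {d : ℕ} (L : Operator d) (Ω : Set (E d)) : Prop :=
  ∃ C : ℝ, 0 < C ∧ ∀ x ∈ Ω, ∀ ξ : E d,
    C⁻¹ * ‖ξ‖ ^ 2 ≤ |∑ i, ∑ j, L.a i j x * ξ i * ξ j| ∧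
    |∑ i, ∑ j, L.a i j x * ξ i * ξ j| ≤ C * ‖ξ‖ ^ 2

/-- All coefficients are of class `C^q(closure Ω)`. -/
def Operator.CoeffClass {d : ℕ} (L : Operator d) (q : ℝ) (Ω : Set (E d)) : Prop :=
  (∀ i j, HolderClass q Ω (L.a i j)) ∧ (∀ i, HolderClass q Ω (L.b i)) ∧ HolderClass q Ω L.c

/-- `u ∈ H^s(Ω)` solves `L u = f` in `Ω`, `u = g` on `∂Ω`. -/
def Operator.IsSolution {d : ℕ} (L : Operator d) (s : ℝ) (Ω : Set (E d)) (f g u : E d → ℝ) :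
    Prop :=
  MemSobolevOn s Ω u ∧ (∀ᵐ x ∂(volume.restrict Ω), L.apply Ω u x = f x) ∧
    ∀ᵐ x ∂(surfaceMeasure Ω), trace Ω u x = g x

/-! ### Kernels and trial spaces -/

/-- The Fourier transform `(2π)^(-d/2) ∫ Φ(x) exp(-i wᵀx) dx`. -/
def fourierTransform {d : ℕ} (Φ : E d → ℝ) (w : E d) : ℂ :=
  (((2 * Real.pi) ^ (-(d : ℝ) / 2) : ℝ) : ℂ) *
    ∫ x, (Φ x : ℂ) * Complex.exp (-Complex.I * ((inner ℝ w x : ℝ) : ℂ))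

/-- A continuous integrable kernel whose Fourier transform is real and lies between two positive
multiples of `(1 + ‖w‖²)^(-τ)`. -/
structure IsSobolevKernel {d : ℕ} (τ : ℝ) (Φ : E d → ℝ) : Prop where
  continuous : Continuous Φ
  integrable : Integrable Φ
  fourier_real : ∀ w, (fourierTransform Φ w).im = 0
  fourier_decay : ∃ C₁ C₂ : ℝ, 0 < C₁ ∧ 0 < C₂ ∧ ∀ w,
    C₁ * (1 + ‖w‖ ^ 2) ^ (-τ) ≤ (fourierTransform Φ w).re ∧
    (fourierTransform Φ w).re ≤ C₂ * (1 + ‖w‖ ^ 2) ^ (-τ)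

/-- The trial space `span {Φ(· - x_j) : x_j ∈ X}`. -/
def trialSpace {d : ℕ} (Φ : E d → ℝ) (X : Finset (E d)) : Submodule ℝ (E d → ℝ) :=
  Submodule.span ℝ ((fun (p x : E d) => Φ (x - p)) '' (X : Set (E d)))

/-- The fill distance `sup_{x ∈ Ω} min_{p ∈ X} ‖x - p‖`. -/
def fillDistance {d : ℕ} (Ω : Set (E d)) (X : Finset (E d)) : ℝ :=
  sSup ((fun x => Metric.infDist x (X : Set (E d))) '' Ω)

/-! ### The weighted discrete least-squares functional -/

/-- The functional `J^h(v; f, g) = ½ (‖L v - f‖²_{L²(Ω)} + h⁻³ ‖v - g‖²_{L²(∂Ω)})`. -/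
def Operator.J {d : ℕ} (L : Operator d) (Ω : Set (E d)) (h : ℝ) (f g v : E d → ℝ) : ℝ :=
  (1 / 2) * ((∫ x in Ω, (L.apply Ω v x - f x) ^ 2)
    + h ^ (-3 : ℤ) * ∫ x, (trace Ω v x - g x) ^ 2 ∂(surfaceMeasure Ω))

/-- The bilinear form `Q^h(v, w) = (L v, L w)_{L²(Ω)} + h⁻³ (v, w)_{L²(∂Ω)}`. -/
def Operator.Q {d : ℕ} (L : Operator d) (Ω : Set (E d)) (h : ℝ) (v w : E d → ℝ) : ℝ :=
  (∫ x in Ω, L.apply Ω v x * L.apply Ω w x)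
    + h ^ (-3 : ℤ) * ∫ x, trace Ω v x * trace Ω w x ∂(surfaceMeasure Ω)

/-- The discrete energy norm `|||v||| = Q^h(v, v)^(1/2)`. -/
def Operator.energyNorm {d : ℕ} (L : Operator d) (Ω : Set (E d)) (h : ℝ) (v : E d → ℝ) : ℝ :=
  Real.sqrt (L.Q Ω h v v)

end LeastSquaresRBF

end

open LeastSquaresRBF

namespace LeastSquaresRBF

open FourierTransform TemperedDistribution Filter Topology
open scoped SchwartzMap ENNReal NNReal LineDeriv

/-! ### Fourier analysis of integrable functions -/

/-! The map `T w = (L w, κ · trace w)` with `κ² = h⁻³` sends `H^{q+2}(Ω)` linearly into the inner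
product space `L²(Ω) × L²(∂Ω)`, and `Q^h` is the inner product pulled back along `T`. Since `u`
solves the problem, `f = L u` and `g = trace u` almost everywhere, so `J^h(v) = ½ ‖T u - T v‖²`.
Minimizing `J^h` is thus best approximation of `T u` from the finite-dimensional space `T(V)`. The
orthogonal projection exists, and Pythagoras gives minimality and the infimum
(`exists_orthogonal_residual`).

Uniqueness of the minimizer as a function needs `T` injective on the trial space. If `T v = 0`, then
`u + v` solves the same problem, so `v = 0` a.e. on `Ω`. By continuity `v` vanishes at every centre,
and positive definiteness of the kernel (`IsSobolevKernel.eq_zero_of_eqOn_centres`) gives `v = 0`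
everywhere.

The remaining work makes `T` well defined and linear. Kernel translates lie in `H^τ` by decay of
their transform. Members of `H^s` have weak derivatives in `H^{s-1}` for `s ≥ 1`
(`MemSobolevOn.exists_hasWeakPartial`), and continuous representatives if `s > d/2`. The boundary
has finite surface measure (`isFiniteMeasure_surfaceMeasure`), so continuous boundary values are
square integrable. Finally `h > 0`, so that the boundary weight is positive. -/

theorem integral_fourier_mul_eq_flip {d : ℕ} {f g : E d → ℂ} (hf : Integrable f)
    (hg : Integrable g) : ∫ ξ, 𝓕 f ξ * g ξ = ∫ x, f x * 𝓕 g x := by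
  have h := VectorFourier.integral_fourierIntegral_smul_eq_flip (μ := volume) (ν := volume)
    (L := innerₗ (E d)) Real.continuous_fourierChar continuous_inner hf hg
  rw [flip_innerₗ] at h
  exact h

theorem integral_fourierInv_mul_eq_flip {d : ℕ} {f g : E d → ℂ} (hf : Integrable f)
    (hg : Integrable g) : ∫ ξ, 𝓕⁻ f ξ * g ξ = ∫ x, f x * 𝓕⁻ g x := by
  have h := integral_fourier_mul_eq_flip hf hg.comp_neg
  rw [← Real.fourierInv_eq_fourier_comp_neg] at h
  rw [← h, ← integral_neg_eq_self]
  simp [Real.fourierInv_eq_fourier_neg]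

theorem continuous_fourier_of_integrable {d : ℕ} {f : E d → ℂ} (hf : Integrable f) :
    Continuous (𝓕 f) :=
  VectorFourier.fourierIntegral_continuous Real.continuous_fourierChar continuous_inner hf

theorem continuous_fourierInv_of_integrable {d : ℕ} {f : E d → ℂ} (hf : Integrable f) :
    Continuous (𝓕⁻ f) := by
  rw [Real.fourierInv_eq_fourier_comp_neg]
  exact continuous_fourier_of_integrable hf.comp_neg

theorem fourier_comp_sub {d : ℕ} (f : E d → ℂ) (p ξ : E d) :
    𝓕 (fun x => f (x - p)) ξ = (Real.fourierChar (-(inner ℝ p ξ)) : ℂ) * 𝓕 f ξ := by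
  have h := congrFun (VectorFourier.fourierIntegral_comp_add_right Real.fourierChar volume
    (innerₗ (E d)) f (-p)) ξ
  simp only [Circle.smul_def] at h
  simpa [sub_eq_add_neg, Function.comp_def] using! h

/-- Conversion between the unitary angular-frequency convention and the kernel `exp(-2πi⟨x, ξ⟩)` of
`𝓕`: substitute `w = 2πξ` and undo the prefactor. -/
theorem fourier_ofReal_eq {d : ℕ} (Φ : E d → ℝ) (ξ : E d) :
    𝓕 (fun x => (Φ x : ℂ)) ξ =
      (((2 * Real.pi) ^ ((d : ℝ) / 2) : ℝ) : ℂ) * fourierTransform Φ ((2 * Real.pi) • ξ) := by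
  rw [fourierTransform, ← mul_assoc, ← Complex.ofReal_mul, ← Real.rpow_add (by positivity),
    Real.fourier_eq']
  rw [show (d : ℝ) / 2 + -(d : ℝ) / 2 = 0 by ring, Real.rpow_zero, Complex.ofReal_one, one_mul]
  congr 1
  ext x
  rw [smul_eq_mul, mul_comm, real_inner_smul_left, real_inner_comm]
  congr 2
  push_cast
  ring

theorem memLp_one_add_norm_sq_rpow {d : ℕ} {s : ℝ} (hs : (d : ℝ) < 2 * s) :
    MemLp (fun x : E d => (1 + ‖x‖ ^ 2) ^ (-s / 2)) 2 := by
  have hc : Continuous fun x : E d => (1 + ‖x‖ ^ 2) ^ (-s / 2) := by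
    apply Continuous.rpow_const (by fun_prop)
    intro x; left; positivity
  rw [memLp_two_iff_integrable_sq hc.aestronglyMeasurable]
  have h := integrable_rpow_neg_one_add_norm_sq (E := E d) (μ := volume) (r := 2 * s)
    (by simpa using hs)
  refine h.congr (ae_of_all _ fun x => ?_)
  dsimp only
  rw [← Real.rpow_natCast (_ ^ _), ← Real.rpow_mul (by positivity)]
  congr 1
  push_cast
  ring

/-- The Bessel weight of order `s` consumes half of the assumed decay. The remaining bound `(1 +
‖ξ‖²)^(-s/2)` is square integrable exactly because `2s > d`. -/
theorem memSobolev_toLp_of_norm_fourier_le {d : ℕ} {s C : ℝ} (hs : (d : ℝ) < 2 * s)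
    {v : E d → ℂ} (hv : Integrable v) (hv2 : MemLp v 2)
    (hb : ∀ ξ, ‖𝓕 v ξ‖ ≤ C * (1 + ‖ξ‖ ^ 2) ^ (-s)) :
    MemSobolev s 2 (Lp.toTemperedDistribution (hv2.toLp v)) := by
  rw [memSobolev_iff_exists_smulLeftCLM_fourier]
  have ht : (fun x : E d => (((1 + ‖x‖ ^ 2) ^ (s / 2) : ℝ) : ℂ)).HasTemperateGrowth := by fun_prop
  have hm : MemLp (fun ξ => (((1 + ‖ξ‖ ^ 2) ^ (s / 2) : ℝ) : ℂ) * 𝓕 v ξ) 2 := by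
    refine ((memLp_one_add_norm_sq_rpow hs).const_mul C).mono
      (ht.1.continuous.mul (continuous_fourier_of_integrable hv)).aestronglyMeasurable
      (ae_of_all _ fun ξ => ?_)
    have h0 : (0 : ℝ) < 1 + ‖ξ‖ ^ 2 := by positivity
    rw [norm_mul, Complex.norm_real, Real.norm_of_nonneg (by positivity)]
    refine le_trans ?_ (le_abs_self _)
    calc (1 + ‖ξ‖ ^ 2) ^ (s / 2) * ‖𝓕 v ξ‖
        ≤ (1 + ‖ξ‖ ^ 2) ^ (s / 2) * (C * (1 + ‖ξ‖ ^ 2) ^ (-s)) := by gcongr; exact hb ξ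
      _ = C * ((1 + ‖ξ‖ ^ 2) ^ (s / 2) * (1 + ‖ξ‖ ^ 2) ^ (-s)) := by ring
      _ = C * (1 + ‖ξ‖ ^ 2) ^ (-s / 2) := by
          rw [← Real.rpow_add h0]
          ring_nf
  refine ⟨hm.toLp _, ?_⟩
  ext g
  rw [smulLeftCLM_apply_apply, TemperedDistribution.fourier_apply, Lp.toTemperedDistribution_apply,
    Lp.toTemperedDistribution_apply]
  have e1 : ∫ x, (𝓕 (SchwartzMap.smulLeftCLM ℂ (fun x : E d =>
      (((1 + ‖x‖ ^ 2) ^ (s / 2) : ℝ) : ℂ)) g)) x • (hv2.toLp v) x =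
      ∫ x, 𝓕 (SchwartzMap.smulLeftCLM ℂ (fun x : E d =>
      (((1 + ‖x‖ ^ 2) ^ (s / 2) : ℝ) : ℂ)) g : E d → ℂ) x * v x := by
    refine integral_congr_ae ?_
    filter_upwards [hv2.coeFn_toLp] with x hx
    rw [hx, SchwartzMap.fourier_coe, smul_eq_mul]
  rw [e1, integral_fourier_mul_eq_flip (SchwartzMap.integrable _) hv]
  refine integral_congr_ae ?_
  filter_upwards [hm.coeFn_toLp] with x hx
  rw [hx, SchwartzMap.smulLeftCLM_apply_apply ht]
  simp only [smul_eq_mul]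
  ring

/-- A member of `H^s` with `s > d / 2` agrees almost everywhere with a continuous function. -/
theorem exists_continuous_ae_eq_of_memSobolev {d : ℕ} {s : ℝ} (hs : (d : ℝ) < 2 * s)
    {F : Lp ℂ 2 (volume : Measure (E d))} (hF : MemSobolev s 2 (Lp.toTemperedDistribution F)) :
    ∃ G : E d → ℂ, Continuous G ∧ F =ᵐ[volume] G := by
  obtain ⟨v, hv⟩ := hF.fourier_memL1 (by simpa using hs)
  have hvi : Integrable v := memLp_one_iff_integrable.mp (Lp.memLp v)
  have hc := continuous_fourierInv_of_integrable hvi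
  refine ⟨𝓕⁻ (v : E d → ℂ), hc, ?_⟩
  -- The candidate is the inverse transform of the integrable function `v` representing the
  -- transform of `F`. Equality is tested on compactly supported smooth functions, seen as Schwartz
  -- functions `φ = 𝓕 (𝓕⁻ φ)`.
  refine ae_eq_of_integral_contDiff_smul_eq ((Lp.memLp F).locallyIntegrable (by norm_num))
    hc.locallyIntegrable fun g hg hgc => ?_
  have hg₁ : HasCompactSupport (Complex.ofRealCLM ∘ g) := hgc.comp_left rfl
  have hg₂ : ContDiff ℝ (⊤ : ℕ∞) (Complex.ofRealCLM ∘ g) := by fun_prop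
  set φ : 𝓢(E d, ℂ) := hg₁.toSchwartzMap hg₂ with hφ
  have h1 : Lp.toTemperedDistribution F φ = Lp.toTemperedDistribution v (𝓕⁻ φ) := by
    rw [← hv, TemperedDistribution.fourier_apply, fourier_fourierInv_eq]
  rw [Lp.toTemperedDistribution_apply, Lp.toTemperedDistribution_apply] at h1
  have h2 := integral_fourierInv_mul_eq_flip (φ.integrable (μ := volume)) hvi
  simp only [smul_eq_mul, SchwartzMap.fourierInv_coe] at h1
  rw [h2] at h1
  have e : ∀ x, φ x = (g x : ℂ) := fun x => by simp [hφ]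
  simp only [e] at h1
  simpa [Complex.real_smul] using h1

/-! ### Sobolev kernels -/

theorem IsSobolevKernel.exists_fourier_eq {d : ℕ} {τ : ℝ} (hτ : 0 ≤ τ) {Φ : E d → ℝ}
    (hΦ : IsSobolevKernel τ Φ) :
    ∃ (m : E d → ℝ) (C : ℝ), (∀ ξ, 𝓕 (fun x => (Φ x : ℂ)) ξ = m ξ) ∧ (∀ ξ, 0 < m ξ) ∧
      ∀ ξ, m ξ ≤ C * (1 + ‖ξ‖ ^ 2) ^ (-τ) := by
  obtain ⟨C₁, C₂, h1, h2, hb⟩ := hΦ.fourier_decay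
  have hc : (0 : ℝ) < (2 * Real.pi) ^ ((d : ℝ) / 2) := by positivity
  refine ⟨fun ξ => (2 * Real.pi) ^ ((d : ℝ) / 2) * (fourierTransform Φ ((2 * Real.pi) • ξ)).re,
    (2 * Real.pi) ^ ((d : ℝ) / 2) * C₂, fun ξ => ?_, fun ξ => ?_, fun ξ => ?_⟩
  · rw [fourier_ofReal_eq, Complex.ofReal_mul]
    congr 1
    exact Complex.ext rfl (hΦ.fourier_real _)
  · exact mul_pos hc (lt_of_lt_of_le (by positivity) (hb _).1)
  · rw [mul_assoc]
    refine mul_le_mul_of_nonneg_left ?_ hc.le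
    refine (hb _).2.trans ?_
    refine mul_le_mul_of_nonneg_left ?_ h2.le
    -- The rescaling by `2π ≥ 1` only enlarges the base, and the exponent `-τ` is nonpositive, so
    -- the bound survives.
    refine Real.rpow_le_rpow_of_nonpos (by positivity) ?_ (by linarith)
    rw [norm_smul, Real.norm_of_nonneg (by positivity)]
    have : (1 : ℝ) ≤ 2 * Real.pi := by linarith [Real.pi_gt_three]
    gcongr
    exact le_mul_of_one_le_left (norm_nonneg ξ) this

theorem IsSobolevKernel.integrable_fourier {d : ℕ} {τ : ℝ} (hτ : (d : ℝ) < 2 * τ) {Φ : E d → ℝ}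
    (hΦ : IsSobolevKernel τ Φ) : Integrable (𝓕 (fun x => (Φ x : ℂ))) := by
  have h0 : 0 ≤ τ := by have : (0 : ℝ) ≤ d := d.cast_nonneg; linarith
  obtain ⟨m, C, hm, hpos, hC⟩ := hΦ.exists_fourier_eq h0
  have h := integrable_rpow_neg_one_add_norm_sq (E := E d) (μ := volume) (r := 2 * τ)
    (by simpa using hτ)
  refine (h.const_mul C).mono'
    (continuous_fourier_of_integrable hΦ.integrable.ofReal).aestronglyMeasurable
    (ae_of_all _ fun ξ => ?_)
  rw [hm, Complex.norm_real, Real.norm_of_nonneg (hpos ξ).le]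
  refine (hC ξ).trans_eq ?_
  ring_nf

/-- Fourier inversion bounds `Φ` by the `L¹` norm of its transform, and a bounded integrable
function is square integrable. -/
theorem IsSobolevKernel.memLp_two {d : ℕ} {τ : ℝ} (hτ : (d : ℝ) < 2 * τ) {Φ : E d → ℝ}
    (hΦ : IsSobolevKernel τ Φ) : MemLp Φ 2 := by
  have hc : Continuous fun x => (Φ x : ℂ) := Complex.continuous_ofReal.comp hΦ.continuous
  have hinv := hc.fourierInv_fourier_eq hΦ.integrable.ofReal (hΦ.integrable_fourier hτ)
  have hb : ∀ x, ‖Φ x‖ ≤ ∫ ξ, ‖𝓕 (fun x => (Φ x : ℂ)) ξ‖ := by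
    intro x
    rw [← Complex.norm_real, ← congrFun hinv x, Real.fourierInv_eq_fourier_neg]
    exact VectorFourier.norm_fourierIntegral_le_integral_norm _ _ _ _ _
  rw [memLp_two_iff_integrable_sq hΦ.continuous.aestronglyMeasurable]
  simp_rw [pow_two]
  exact hΦ.integrable.bdd_mul hΦ.continuous.aestronglyMeasurable (ae_of_all _ hb)

theorem IsSobolevKernel.memSobolevOn_comp_sub {d : ℕ} {τ : ℝ} (hτ : (d : ℝ) < 2 * τ)
    {Φ : E d → ℝ} (hΦ : IsSobolevKernel τ Φ) (Ω : Set (E d)) (p : E d) :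
    MemSobolevOn τ Ω (fun x => Φ (x - p)) := by
  have h0 : 0 ≤ τ := by have : (0 : ℝ) ≤ d := d.cast_nonneg; linarith
  obtain ⟨m, C, hm, hpos, hC⟩ := hΦ.exists_fourier_eq h0
  have h2 : MemLp (fun x => ((Φ (x - p) : ℝ) : ℂ)) 2 :=
    ((hΦ.memLp_two hτ).comp_measurePreserving (measurePreserving_sub_right volume p)).ofReal
  refine ⟨h2.toLp _, memSobolev_toLp_of_norm_fourier_le (C := C) hτ
    (hΦ.integrable.comp_sub_right p).ofReal h2 fun ξ => ?_, ae_restrict_of_ae h2.coeFn_toLp⟩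
  have hf := fourier_comp_sub (fun x => (Φ x : ℂ)) p ξ
  erw [hf]
  rw [norm_mul, Circle.norm_coe, one_mul, hm,
    Complex.norm_real, Real.norm_of_nonneg (hpos ξ).le]
  exact hC ξ

theorem exists_sum_eq_of_mem_trialSpace {d : ℕ} {Φ : E d → ℝ} {X : Finset (E d)} {v : E d → ℝ}
    (hv : v ∈ trialSpace Φ X) : ∃ c : E d → ℝ, v = fun x => ∑ p ∈ X, c p * Φ (x - p) := by
  rw [trialSpace, Submodule.mem_span_image_finset_iff_exists_fun'] at hv
  obtain ⟨c, rfl⟩ := hv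
  refine ⟨c, ?_⟩
  ext x
  simp

theorem continuous_of_mem_trialSpace {d : ℕ} {Φ : E d → ℝ} (hΦ : Continuous Φ)
    {X : Finset (E d)} {v : E d → ℝ} (hv : v ∈ trialSpace Φ X) : Continuous v := by
  obtain ⟨c, rfl⟩ := exists_sum_eq_of_mem_trialSpace hv
  fun_prop

/-- The kernel is positive definite: a member of the trial space vanishing at all centres is zero. -/
theorem IsSobolevKernel.eq_zero_of_eqOn_centres {d : ℕ} {τ : ℝ} (hτ : (d : ℝ) < 2 * τ)
    {Φ : E d → ℝ} (hΦ : IsSobolevKernel τ Φ) {X : Finset (E d)} {v : E d → ℝ}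
    (hv : v ∈ trialSpace Φ X) (h0 : ∀ p ∈ X, v p = 0) : v = 0 := by
  have hτ0 : 0 ≤ τ := by have : (0 : ℝ) ≤ d := d.cast_nonneg; linarith
  obtain ⟨m, C, hm, hpos, hC⟩ := hΦ.exists_fourier_eq hτ0
  have hvc : Continuous fun x => (v x : ℂ) :=
    Complex.continuous_ofReal.comp (continuous_of_mem_trialSpace hΦ.continuous hv)
  obtain ⟨c, hc⟩ := exists_sum_eq_of_mem_trialSpace hv
  have hshift : ∀ p, Integrable fun x => (Φ (x - p) : ℂ) := fun p =>
    (hΦ.integrable.comp_sub_right p).ofReal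
  have hveq : (fun x => (v x : ℂ)) = fun x => ∑ p ∈ X, (c p : ℂ) * (Φ (x - p) : ℂ) := by
    ext x; rw [hc]; push_cast; rfl
  have hvi : Integrable fun x => (v x : ℂ) := by
    rw [hveq]
    exact integrable_finsetSum _ fun p _ => (hshift p).const_mul _
  -- Translation becomes modulation, so the transform of `v` factors as the positive symbol `m`
  -- times this exponential sum.
  set S : E d → ℂ := fun ξ => ∑ p ∈ X, (c p : ℂ) * (Real.fourierChar (-(inner ℝ p ξ)) : ℂ) with hS
  have hfour : ∀ ξ, 𝓕 (fun x => (v x : ℂ)) ξ = m ξ * S ξ := by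
    intro ξ
    rw [hveq, Real.fourier_eq]
    simp_rw [Finset.smul_sum]
    rw [integral_finsetSum]
    · rw [hS, Finset.mul_sum]
      refine Finset.sum_congr rfl fun p _ => ?_
      have := fourier_comp_sub (fun x => (Φ x : ℂ)) p ξ
      rw [Real.fourier_eq, hm] at this
      have hcomm : ∀ x, Real.fourierChar (-(inner ℝ x ξ)) • ((c p : ℂ) * (Φ (x - p) : ℂ)) =
          (c p : ℂ) * (Real.fourierChar (-(inner ℝ x ξ)) • (Φ (x - p) : ℂ)) := fun x => by
        simp only [Circle.smul_def, smul_eq_mul]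
        ring
      simp only [hcomm]
      rw [integral_const_mul, this]
      ring
    · intro p _
      exact (Real.fourierIntegral_convergent_iff ξ).mpr ((hshift p).const_mul _)
  have hScont : Continuous S := by
    refine continuous_finsetSum _ fun p _ => continuous_const.mul ?_
    simp_rw [Real.fourierChar_apply]
    fun_prop
  have hmint : Integrable m := by
    have h := hΦ.integrable_fourier hτ
    have : 𝓕 (fun x => (Φ x : ℂ)) = fun ξ => (m ξ : ℂ) := funext hm
    rw [this] at h
    simpa using h.re
  have hmcont : Continuous m := by
    have h := continuous_fourier_of_integrable hΦ.integrable.ofReal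
    have h' : 𝓕 (fun x => (Φ x : ℂ)) = fun ξ => (m ξ : ℂ) := funext hm
    erw [h'] at h
    exact Complex.continuous_re.comp h
  have hSb : ∀ ξ, ‖S ξ‖ ≤ ∑ p ∈ X, |c p| := fun ξ =>
    (norm_sum_le _ _).trans_eq (Finset.sum_congr rfl fun p _ => by
      rw [norm_mul, Circle.norm_coe, mul_one, Complex.norm_real, Real.norm_eq_abs])
  have hvhat : Integrable (𝓕 (fun x => (v x : ℂ))) := by
    rw [funext hfour]
    have hmC : Integrable fun ξ => (m ξ : ℂ) := hmint.ofReal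
    simpa only [mul_comm] using
      hmC.bdd_mul hScont.aestronglyMeasurable (ae_of_all _ hSb)
  have hinv := hvc.fourierInv_fourier_eq hvi hvhat
  have hval : ∀ p ∈ X, ∫ ξ, (Real.fourierChar (inner ℝ ξ p) : ℂ) * (m ξ * S ξ) = 0 := by
    intro p hp
    have := congrFun hinv p
    rw [h0 p hp, Real.fourierInv_eq] at this
    simpa [Circle.smul_def, hfour] using this
  -- By inversion `∑ c_p v(p) = ∫ m |S|²`, the coefficients reassembling the conjugate of `S`; every
  -- `v(p)` is zero.
  have hquad : ∫ ξ, m ξ * ‖S ξ‖ ^ 2 = 0 := by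
    have hc : ((∫ ξ, m ξ * ‖S ξ‖ ^ 2 : ℝ) : ℂ) = 0 := by
      rw [← integral_complex_ofReal]
      have : ∀ ξ, ((m ξ * ‖S ξ‖ ^ 2 : ℝ) : ℂ) =
          ∑ p ∈ X, (c p : ℂ) * ((Real.fourierChar (inner ℝ ξ p) : ℂ) * (m ξ * S ξ)) := by
        intro ξ
        have hconj : (starRingEnd ℂ) (S ξ) =
            ∑ p ∈ X, (c p : ℂ) * (Real.fourierChar (inner ℝ ξ p) : ℂ) := by
          rw [hS, map_sum]
          refine Finset.sum_congr rfl fun p _ => ?_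
          rw [map_mul, Complex.conj_ofReal, ← Circle.coe_inv_eq_conj, ← AddChar.map_neg_eq_inv,
            neg_neg, real_inner_comm]
        push_cast
        rw [← Complex.mul_conj', hconj, Finset.mul_sum, Finset.mul_sum]
        exact Finset.sum_congr rfl fun p _ => by ring
      simp_rw [this]
      rw [integral_finsetSum]
      · refine Finset.sum_eq_zero fun p hp => ?_
        rw [integral_const_mul, hval p hp, mul_zero]
      · intro p _
        refine Integrable.const_mul ?_ _
        have := (Real.fourierIntegral_convergent_iff (μ := volume) (-p)).mpr hvhat
        simpa [Circle.smul_def, hfour] using this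
    exact_mod_cast hc
  have hae : (fun ξ => m ξ * ‖S ξ‖ ^ 2) =ᵐ[volume] 0 := by
    refine (integral_eq_zero_iff_of_nonneg (fun ξ => mul_nonneg (hpos ξ).le (sq_nonneg _)) ?_).mp
      hquad
    have h := hmint.bdd_mul (f := fun ξ => ‖S ξ‖ ^ 2) (c := (∑ p ∈ X, |c p|) ^ 2)
      (by fun_prop) (ae_of_all _ fun ξ => ?_)
    · simpa only [mul_comm] using h
    · rw [norm_pow, norm_norm]
      gcongr
      exact hSb ξ
  -- Continuity upgrades a.e. vanishing to everywhere. As `m > 0`, `S` vanishes, hence so does the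
  -- transform of `v`, and inversion gives `v = 0` without linear independence of the exponentials.
  have hzero := (hmcont.mul (hScont.norm.pow 2)).ae_eq_iff_eq (μ := volume) continuous_zero |>.mp hae
  have hS0 : ∀ ξ, S ξ = 0 := fun ξ => by
    have := congrFun hzero ξ
    simpa [(hpos ξ).ne'] using this
  ext x
  have := congrFun hinv x
  rw [Real.fourierInv_eq] at this
  simp only [hfour, hS0, mul_zero, smul_zero, integral_zero] at this
  exact_mod_cast this.symm

/-! ### Weak partial derivatives -/

theorem integrableOn_mul_of_tsupport_subset {d : ℕ} {Ω : Set (E d)} {f ψ : E d → ℝ}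
    (hf : LocallyIntegrableOn f Ω) (hψ : Continuous ψ) (hc : HasCompactSupport ψ)
    (hs : tsupport ψ ⊆ Ω) : IntegrableOn (fun x => f x * ψ x) Ω := by
  have h1 : IntegrableOn f (tsupport ψ) := hf.integrableOn_compact_subset hs hc
  have h2 : IntegrableOn (fun x => f x * ψ x) (tsupport ψ) :=
    h1.mul_continuousOn hψ.continuousOn hc
  rw [integrableOn_iff_integrable_of_support_subset] at h2
  · exact h2.integrableOn
  · exact (Function.support_mul_subset_right f ψ).trans (subset_tsupport ψ)

theorem continuous_fderiv_apply_dir {d : ℕ} {φ : E d → ℝ} (hφ : ContDiff ℝ (⊤ : ℕ∞) φ)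
    (i : Fin d) : Continuous fun x => fderiv ℝ φ x (dir i) :=
  (hφ.continuous_fderiv (by simp)).clm_apply continuous_const

theorem integrableOn_mul_fderiv {d : ℕ} {Ω : Set (E d)} {f φ : E d → ℝ}
    (hf : LocallyIntegrableOn f Ω) (hφ : ContDiff ℝ (⊤ : ℕ∞) φ) (hc : HasCompactSupport φ)
    (hs : tsupport φ ⊆ Ω) (i : Fin d) :
    IntegrableOn (fun x => f x * fderiv ℝ φ x (dir i)) Ω :=
  integrableOn_mul_of_tsupport_subset hf (continuous_fderiv_apply_dir hφ i)
    (hc.fderiv_apply ℝ (dir i)) ((tsupport_fderiv_apply_subset ℝ (dir i)).trans hs)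

theorem HasWeakPartial.add {d : ℕ} {Ω : Set (E d)} {i : Fin d} {f₁ f₂ g₁ g₂ : E d → ℝ}
    (h₁ : HasWeakPartial Ω i f₁ g₁) (h₂ : HasWeakPartial Ω i f₂ g₂) :
    HasWeakPartial Ω i (f₁ + f₂) (g₁ + g₂) := by
  refine ⟨h₁.1.add h₂.1, h₁.2.1.add h₂.2.1, fun φ hφ hc hs => ?_⟩
  simp only [Pi.add_apply, add_mul]
  rw [integral_add (integrableOn_mul_fderiv h₁.1 hφ hc hs i)
      (integrableOn_mul_fderiv h₂.1 hφ hc hs i),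
    integral_add (integrableOn_mul_of_tsupport_subset h₁.2.1 hφ.continuous hc hs)
      (integrableOn_mul_of_tsupport_subset h₂.2.1 hφ.continuous hc hs),
    h₁.2.2 φ hφ hc hs, h₂.2.2 φ hφ hc hs]
  ring

theorem HasWeakPartial.const_smul {d : ℕ} {Ω : Set (E d)} {i : Fin d} {f g : E d → ℝ}
    (h : HasWeakPartial Ω i f g) (c : ℝ) : HasWeakPartial Ω i (c • f) (c • g) := by
  refine ⟨h.1.smul c, h.2.1.smul c, fun φ hφ hc hs => ?_⟩
  simp only [Pi.smul_apply, smul_eq_mul, mul_assoc]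
  rw [integral_const_mul, integral_const_mul, h.2.2 φ hφ hc hs]
  ring

theorem HasWeakPartial.congr_left {d : ℕ} {Ω : Set (E d)} {i : Fin d}
    {f f' g : E d → ℝ} (h : HasWeakPartial Ω i f g) (hf : f =ᵐ[volume.restrict Ω] f') :
    HasWeakPartial Ω i f' g := by
  refine ⟨h.1.congr hf, h.2.1, fun φ hφ hc hs => ?_⟩
  rw [← h.2.2 φ hφ hc hs]
  refine integral_congr_ae ?_
  filter_upwards [hf] with x hx
  rw [hx]

theorem HasWeakPartial.ae_unique {d : ℕ} {Ω : Set (E d)} (hΩ : IsOpen Ω) {i : Fin d}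
    {f g g' : E d → ℝ} (h : HasWeakPartial Ω i f g) (h' : HasWeakPartial Ω i f g') :
    g =ᵐ[volume.restrict Ω] g' := by
  have key := hΩ.ae_eq_zero_of_integral_contDiff_smul_eq_zero (h.2.1.sub h'.2.1)
    fun φ hφ hc hs => by
      have e1 := h.2.2 φ hφ hc hs
      rw [h'.2.2 φ hφ hc hs, neg_inj] at e1
      rw [← setIntegral_eq_integral_of_forall_compl_eq_zero (s := Ω)]
      · simp only [Pi.sub_apply, smul_eq_mul, mul_comm (φ _), sub_mul]
        rw [integral_sub (integrableOn_mul_of_tsupport_subset h.2.1 hφ.continuous hc hs)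
          (integrableOn_mul_of_tsupport_subset h'.2.1 hφ.continuous hc hs), e1, sub_self]
      · intro x hx
        rw [image_eq_zero_of_notMem_tsupport (fun hx' => hx (hs hx')), zero_smul]
  filter_upwards [(ae_restrict_iff' hΩ.measurableSet).mpr key] with x hx
  simpa [sub_eq_zero] using hx

/-- `weakPartial` is an arbitrary choice, so its calculus holds only almost everywhere; each rule is
reduced through this lemma to one for `HasWeakPartial`. -/
theorem HasWeakPartial.weakPartial_ae_eq {d : ℕ} {Ω : Set (E d)} (hΩ : IsOpen Ω) {i : Fin d}
    {f g : E d → ℝ} (h : HasWeakPartial Ω i f g) :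
    weakPartial Ω i f =ᵐ[volume.restrict Ω] g := by
  have hex : ∃ g, HasWeakPartial Ω i f g := ⟨g, h⟩
  rw [weakPartial, dif_pos hex]
  exact hex.choose_spec.ae_unique hΩ h

theorem hasWeakPartial_weakPartial {d : ℕ} {Ω : Set (E d)} {i : Fin d} {f : E d → ℝ}
    (h : ∃ g, HasWeakPartial Ω i f g) : HasWeakPartial Ω i f (weakPartial Ω i f) := by
  rw [weakPartial, dif_pos h]
  exact h.choose_spec

theorem weakPartial_congr_ae {d : ℕ} {Ω : Set (E d)} (hΩ : IsOpen Ω) {i : Fin d}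
    {f f' : E d → ℝ} (h : ∃ g, HasWeakPartial Ω i f g) (hf : f =ᵐ[volume.restrict Ω] f') :
    weakPartial Ω i f' =ᵐ[volume.restrict Ω] weakPartial Ω i f :=
  ((hasWeakPartial_weakPartial h).congr_left hf).weakPartial_ae_eq hΩ

theorem weakPartial_add_ae {d : ℕ} {Ω : Set (E d)} (hΩ : IsOpen Ω) {i : Fin d}
    {f₁ f₂ : E d → ℝ} (h₁ : ∃ g, HasWeakPartial Ω i f₁ g) (h₂ : ∃ g, HasWeakPartial Ω i f₂ g) :
    weakPartial Ω i (f₁ + f₂) =ᵐ[volume.restrict Ω]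
      weakPartial Ω i f₁ + weakPartial Ω i f₂ :=
  ((hasWeakPartial_weakPartial h₁).add (hasWeakPartial_weakPartial h₂)).weakPartial_ae_eq hΩ

theorem weakPartial_const_smul_ae {d : ℕ} {Ω : Set (E d)} (hΩ : IsOpen Ω) {i : Fin d}
    {f : E d → ℝ} (h : ∃ g, HasWeakPartial Ω i f g) (c : ℝ) :
    weakPartial Ω i (c • f) =ᵐ[volume.restrict Ω] c • weakPartial Ω i f :=
  ((hasWeakPartial_weakPartial h).const_smul c).weakPartial_ae_eq hΩ

/-! ### Sobolev functions on a set -/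

theorem MemSobolevOn.add {d : ℕ} {s : ℝ} {Ω : Set (E d)} {f g : E d → ℝ}
    (hf : MemSobolevOn s Ω f) (hg : MemSobolevOn s Ω g) : MemSobolevOn s Ω (f + g) := by
  obtain ⟨F, hF, hfF⟩ := hf
  obtain ⟨G, hG, hgG⟩ := hg
  refine ⟨F + G, ?_, ?_⟩
  · have := hF.add hG
    simp only [← Lp.toTemperedDistributionCLM_apply] at this ⊢
    rwa [map_add]
  · filter_upwards [hfF, hgG, ae_restrict_of_ae (Lp.coeFn_add F G)] with x h1 h2 h3
    rw [h3, Pi.add_apply, h1, h2, Pi.add_apply, Complex.ofReal_add]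

theorem MemSobolevOn.const_smul {d : ℕ} {s : ℝ} {Ω : Set (E d)} {f : E d → ℝ}
    (hf : MemSobolevOn s Ω f) (c : ℝ) : MemSobolevOn s Ω (c • f) := by
  obtain ⟨F, hF, hfF⟩ := hf
  refine ⟨(c : ℂ) • F, ?_, ?_⟩
  · have := hF.smul (c : ℂ)
    simp only [← Lp.toTemperedDistributionCLM_apply] at this ⊢
    rwa [map_smul]
  · filter_upwards [hfF, ae_restrict_of_ae (Lp.coeFn_smul (c : ℂ) F)] with x h1 h2
    rw [h2, Pi.smul_apply, h1, Pi.smul_apply, smul_eq_mul, smul_eq_mul, Complex.ofReal_mul]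

theorem MemSobolevOn.zero {d : ℕ} {s : ℝ} {Ω : Set (E d)} : MemSobolevOn s Ω 0 := by
  refine ⟨0, ?_, ?_⟩
  · simpa only [← Lp.toTemperedDistributionCLM_apply, map_zero] using
      memSobolev_fun_zero (E d) ℂ s 2
  · exact ae_restrict_of_ae (by
      filter_upwards [Lp.coeFn_zero ℂ 2 (volume : Measure (E d))] with x hx
      rw [hx, Pi.zero_apply, Pi.zero_apply, Complex.ofReal_zero])

theorem MemSobolevOn.mono {d : ℕ} {s s' : ℝ} (h : s' ≤ s) {Ω : Set (E d)} {f : E d → ℝ}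
    (hf : MemSobolevOn s Ω f) : MemSobolevOn s' Ω f := by
  obtain ⟨F, hF, hfF⟩ := hf
  exact ⟨F, hF.mono h, hfF⟩

theorem MemSobolevOn.congr_ae {d : ℕ} {s : ℝ} {Ω : Set (E d)} {f g : E d → ℝ}
    (hf : MemSobolevOn s Ω f) (h : f =ᵐ[volume.restrict Ω] g) : MemSobolevOn s Ω g := by
  obtain ⟨F, hF, hfF⟩ := hf
  refine ⟨F, hF, ?_⟩
  filter_upwards [hfF, h] with x h1 h2
  rw [h1, h2]

theorem MemSobolevOn.memLp {d : ℕ} {s : ℝ} {Ω : Set (E d)} {f : E d → ℝ}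
    (hf : MemSobolevOn s Ω f) : MemLp f 2 (volume.restrict Ω) := by
  obtain ⟨F, hF, hfF⟩ := hf
  refine (((Lp.memLp F).restrict Ω).re).ae_eq ?_
  filter_upwards [hfF] with x hx
  simp [hx]

/-- The distributional derivative of the extension `F` lies in `H^{s-1}`, and `s ≥ 1` makes it an
`L²` function `G`. Test functions supported in `Ω` see only `f`, so `Re G` is the weak derivative
there. The extension may be complex off `Ω`, hence the separate treatment of `Im G`. -/
theorem MemSobolevOn.exists_hasWeakPartial {d : ℕ} {s : ℝ} (hs : 1 ≤ s) {Ω : Set (E d)}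
    (hΩ : IsOpen Ω) {f : E d → ℝ} (hf : MemSobolevOn s Ω f) (i : Fin d) :
    ∃ g, HasWeakPartial Ω i f g ∧ MemSobolevOn (s - 1) Ω g := by
  have hfL := hf.memLp
  obtain ⟨F, hF, hfF⟩ := hf
  have hD : MemSobolev (s - 1) 2 (∂_{dir i} (Lp.toTemperedDistribution F)) := hF.lineDerivOp
  obtain ⟨G, hG⟩ := memSobolev_zero_iff.mp (hD.mono (sub_nonneg.mpr hs))
  rw [hG] at hD
  have hGL : LocallyIntegrable G := (Lp.memLp G).locallyIntegrable (by norm_num)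
  have hre : LocallyIntegrable fun x => (G x).re := (Lp.memLp G).re.locallyIntegrable (by norm_num)
  have him : LocallyIntegrable fun x => (G x).im := (Lp.memLp G).im.locallyIntegrable (by norm_num)
  have hfl : LocallyIntegrableOn f Ω := locallyIntegrableOn_of_locallyIntegrable_restrict
    (hfL.locallyIntegrable (by norm_num))
  have key : ∀ φ : E d → ℝ, ContDiff ℝ (⊤ : ℕ∞) φ → HasCompactSupport φ → tsupport φ ⊆ Ω →
      ∫ x in Ω, G x * φ x = -((∫ x in Ω, f x * fderiv ℝ φ x (dir i) : ℝ) : ℂ) := by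
    intro φ hφ hc hsupp
    have hg₁ : HasCompactSupport (Complex.ofRealCLM ∘ φ) := hc.comp_left rfl
    have hg₂ : ContDiff ℝ (⊤ : ℕ∞) (Complex.ofRealCLM ∘ φ) := by fun_prop
    set ψ : 𝓢(E d, ℂ) := hg₁.toSchwartzMap hg₂ with hψ
    have e0 : ∀ x, ψ x = (φ x : ℂ) := fun x => by simp [hψ]
    have e1 : ∀ x, (∂_{dir i} ψ) x = (fderiv ℝ φ x (dir i) : ℂ) := fun x => by
      rw [SchwartzMap.lineDerivOp_apply_eq_fderiv]
      have : (ψ : E d → ℂ) = Complex.ofRealCLM ∘ φ := by ext y; simp [hψ]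
      rw [this, fderiv_comp _ Complex.ofRealCLM.differentiableAt
        (hφ.differentiable (by simp) x)]
      simp
    have h1 : Lp.toTemperedDistribution G ψ = -Lp.toTemperedDistribution F (∂_{dir i} ψ) := by
      rw [← hG, lineDerivOp_apply_apply, map_neg]
    rw [Lp.toTemperedDistribution_apply, Lp.toTemperedDistribution_apply] at h1
    simp only [e0, e1, smul_eq_mul] at h1
    rw [← setIntegral_eq_integral_of_forall_compl_eq_zero (s := Ω),
      ← setIntegral_eq_integral_of_forall_compl_eq_zero (s := Ω)
        (f := fun x => (fderiv ℝ φ x (dir i) : ℂ) * F x)] at h1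
    · simp only [mul_comm (G _)]
      rw [h1, ← integral_complex_ofReal]
      congr 1
      refine integral_congr_ae ?_
      filter_upwards [hfF] with x hx
      rw [hx]
      push_cast
      ring
    · intro x hx
      have : fderiv ℝ φ x (dir i) = 0 := image_eq_zero_of_notMem_tsupport
        (f := fun x => fderiv ℝ φ x (dir i))
        fun hx' => hx (hsupp (tsupport_fderiv_apply_subset ℝ (dir i) hx'))
      rw [this]; simp
    · intro x hx
      rw [image_eq_zero_of_notMem_tsupport (f := φ) (fun hx' => hx (hsupp hx'))]; simp
  have hint : ∀ φ : E d → ℝ, ContDiff ℝ (⊤ : ℕ∞) φ → HasCompactSupport φ → tsupport φ ⊆ Ω →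
      IntegrableOn (fun x => G x * (φ x : ℂ)) Ω := by
    intro φ hφ hc hsupp
    have h1 := (integrableOn_mul_of_tsupport_subset (hre.locallyIntegrableOn Ω)
      hφ.continuous hc hsupp).ofReal (𝕜 := ℂ)
    have h2 := (integrableOn_mul_of_tsupport_subset (him.locallyIntegrableOn Ω)
      hφ.continuous hc hsupp).ofReal (𝕜 := ℂ)
    refine (h1.add (h2.mul_const Complex.I)).congr (ae_of_all _ fun x => ?_)
    apply Complex.ext <;> simp
  have hreint : ∀ φ : E d → ℝ, ContDiff ℝ (⊤ : ℕ∞) φ → HasCompactSupport φ → tsupport φ ⊆ Ω →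
      ∫ x in Ω, (G x).re * φ x = -∫ x in Ω, f x * fderiv ℝ φ x (dir i) := by
    intro φ hφ hc hsupp
    have h := congrArg Complex.re (key φ hφ hc hsupp)
    have h2 := integral_re (hint φ hφ hc hsupp)
    simp only [RCLike.re_to_complex] at h2
    rw [← h2] at h
    simpa using h
  have himint : ∀ φ : E d → ℝ, ContDiff ℝ (⊤ : ℕ∞) φ → HasCompactSupport φ → tsupport φ ⊆ Ω →
      ∫ x in Ω, (G x).im * φ x = 0 := by
    intro φ hφ hc hsupp
    have h := congrArg Complex.im (key φ hφ hc hsupp)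
    have h2 := integral_im (hint φ hφ hc hsupp)
    simp only [RCLike.im_to_complex] at h2
    rw [← h2] at h
    simpa using h
  refine ⟨fun x => (G x).re, ⟨hfl, hre.locallyIntegrableOn Ω, fun φ hφ hc hsupp => ?_⟩, G, hD, ?_⟩
  · rw [hreint φ hφ hc hsupp, neg_neg]
  -- `Im G` integrates to zero against every test function, so `G` is real a.e. on `Ω` and is itself
  -- the required `H^{s-1}` extension of `Re G`.
  · have h0 := hΩ.ae_eq_zero_of_integral_contDiff_smul_eq_zero (him.locallyIntegrableOn Ω)
      fun φ hφ hc hsupp => by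
        rw [← setIntegral_eq_integral_of_forall_compl_eq_zero (s := Ω),
          ← himint φ hφ hc hsupp]
        · simp only [smul_eq_mul, mul_comm]
        · intro x hx
          rw [image_eq_zero_of_notMem_tsupport (fun hx' => hx (hsupp hx')), zero_smul]
    filter_upwards [(ae_restrict_iff' hΩ.measurableSet).mpr h0] with x hx
    exact Complex.ext (by simp) (by simpa using hx)

theorem MemSobolevOn.weakPartial {d : ℕ} {s : ℝ} (hs : 1 ≤ s) {Ω : Set (E d)}
    (hΩ : IsOpen Ω) {f : E d → ℝ} (hf : MemSobolevOn s Ω f) (i : Fin d) :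
    (∃ g, HasWeakPartial Ω i f g) ∧ MemSobolevOn (s - 1) Ω (weakPartial Ω i f) := by
  obtain ⟨g, hg, hgs⟩ := hf.exists_hasWeakPartial hs hΩ i
  exact ⟨⟨g, hg⟩, hgs.congr_ae (hg.weakPartial_ae_eq hΩ).symm⟩

/-! ### Boundary values -/

/-- Nonempty open sets have positive measure, and `Ω` is dense in its closure. This determines the
chosen `trace` on `∂Ω`, a null set for many domains, and makes it linear there. -/
theorem eqOn_closure_of_ae_eq {d : ℕ} {Ω : Set (E d)} (hΩ : IsOpen Ω) {G₁ G₂ : E d → ℝ}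
    (h₁ : ContinuousOn G₁ (closure Ω)) (h₂ : ContinuousOn G₂ (closure Ω))
    (h : G₁ =ᵐ[volume.restrict Ω] G₂) : Set.EqOn G₁ G₂ (closure Ω) :=
  (Measure.eqOn_open_of_ae_eq h hΩ (h₁.mono subset_closure)
    (h₂.mono subset_closure)).of_subset_closure h₁ h₂ subset_closure subset_rfl

theorem MemSobolevOn.trace_spec {d : ℕ} {s : ℝ} (hs : (d : ℝ) < 2 * s) {Ω : Set (E d)}
    {f : E d → ℝ} (hf : MemSobolevOn s Ω f) :
    ContinuousOn (trace Ω f) (closure Ω) ∧ f =ᵐ[volume.restrict Ω] trace Ω f := by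
  have hex : ∃ G : E d → ℝ, ContinuousOn G (closure Ω) ∧ f =ᵐ[volume.restrict Ω] G := by
    obtain ⟨F, hF, hfF⟩ := hf
    obtain ⟨G, hG, hFG⟩ := exists_continuous_ae_eq_of_memSobolev hs hF
    refine ⟨fun x => (G x).re, (Complex.continuous_re.comp hG).continuousOn, ?_⟩
    filter_upwards [hfF, ae_restrict_of_ae hFG] with x h1 h2
    rw [← h2, h1, Complex.ofReal_re]
  rw [trace, dif_pos hex]
  exact hex.choose_spec

theorem trace_add_eqOn {d : ℕ} {s : ℝ} (hs : (d : ℝ) < 2 * s) {Ω : Set (E d)} (hΩ : IsOpen Ω)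
    {f g : E d → ℝ} (hf : MemSobolevOn s Ω f) (hg : MemSobolevOn s Ω g) :
    Set.EqOn (trace Ω (f + g)) (trace Ω f + trace Ω g) (closure Ω) := by
  obtain ⟨c1, e1⟩ := hf.trace_spec hs
  obtain ⟨c2, e2⟩ := hg.trace_spec hs
  obtain ⟨c3, e3⟩ := (hf.add hg).trace_spec hs
  exact eqOn_closure_of_ae_eq hΩ c3 (c1.add c2) (e3.symm.trans (e1.add e2))

theorem trace_const_smul_eqOn {d : ℕ} {s : ℝ} (hs : (d : ℝ) < 2 * s) {Ω : Set (E d)}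
    (hΩ : IsOpen Ω) {f : E d → ℝ} (hf : MemSobolevOn s Ω f) (c : ℝ) :
    Set.EqOn (trace Ω (c • f)) (c • trace Ω f) (closure Ω) := by
  obtain ⟨c1, e1⟩ := hf.trace_spec hs
  obtain ⟨c3, e3⟩ := (hf.const_smul c).trace_spec hs
  exact eqOn_closure_of_ae_eq hΩ c3 (c1.const_smul c) (e3.symm.trans (e1.const_smul c))

/-! ### Hölder classes and the surface measure -/

theorem HolderClass.continuousOn {d : ℕ} {r : ℝ} {U : Set (E d)} {γ : E d → ℝ}
    (h : HolderClass r U γ) : ContinuousOn γ U :=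
  h.1.continuousOn

theorem HolderClass.exists_iteratedFDeriv_bound {d : ℕ} {r : ℝ} {U : Set (E d)}
    (hU : Bornology.IsBounded U) {γ : E d → ℝ} (h : HolderClass r U γ) {k : ℕ}
    (hk : k ≤ ⌊r⌋₊) : ∃ C, ∀ x ∈ U, ‖iteratedFDeriv ℝ k γ x‖ ≤ C := by
  obtain ⟨G, hG, he⟩ := h.2.1 k hk
  obtain ⟨C, hC⟩ := hU.isCompact_closure.exists_bound_of_continuousOn hG
  exact ⟨C, fun x hx => he hx ▸ hC x (subset_closure hx)⟩

theorem HolderClass.exists_bound {d : ℕ} {r : ℝ} {U : Set (E d)}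
    (hU : Bornology.IsBounded U) {γ : E d → ℝ} (h : HolderClass r U γ) :
    ∃ C, ∀ x ∈ U, ‖γ x‖ ≤ C := by
  simpa using h.exists_iteratedFDeriv_bound hU (Nat.zero_le _)

theorem HolderClass.exists_lipschitzOnWith {d : ℕ} {r : ℝ} (hr : 1 ≤ r) {x : E d} {ε : ℝ}
    {γ : E d → ℝ} (h : HolderClass r (Metric.ball x ε) γ) :
    ∃ K : ℝ≥0, LipschitzOnWith K γ (Metric.ball x ε) := by
  have h1 : 1 ≤ ⌊r⌋₊ := (Nat.one_le_floor_iff r).mpr hr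
  obtain ⟨C, hC⟩ := h.exists_iteratedFDeriv_bound Metric.isBounded_ball h1
  refine ⟨C.toNNReal, (convex_ball x ε).lipschitzOnWith_of_nnnorm_fderiv_le (𝕜 := ℝ)
    (fun y hy => ?_) fun y hy => ?_⟩
  · exact (h.1.contDiffAt (Metric.isOpen_ball.mem_nhds hy)).differentiableAt
      (by exact_mod_cast (Nat.one_le_iff_ne_zero.mp h1))
  · rw [← NNReal.coe_le_coe, coe_nnnorm, ← norm_iteratedFDeriv_one]
    exact (hC y hy).trans (Real.le_coe_toNNReal C)

/-- Either strict inequality between `γ` and the height persists nearby, making `x` interior to `Ω`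
or to its complement. The base point stays in the ball because an isometry followed by a coordinate
projection does not increase distances. -/
theorem graph_of_mem_frontier {d : ℕ} {Ω : Set (E d)} {p : E d} {ε : ℝ}
    {ψ : E d ≃ₗᵢ[ℝ] WithLp 2 (E (d - 1) × ℝ)} {γ : E (d - 1) → ℝ}
    (hγ : ContinuousOn γ (Metric.ball (ψ p).fst ε))
    (h : ∀ x ∈ Metric.ball p ε, x ∈ Ω ↔ γ (ψ x).fst < (ψ x).snd)
    {x : E d} (hx : x ∈ Metric.ball p ε) (hf : x ∈ frontier Ω) :
    (ψ x).fst ∈ Metric.ball (ψ p).fst ε ∧ γ (ψ x).fst = (ψ x).snd := by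
  have hmaps : ∀ y ∈ Metric.ball p ε, (ψ y).fst ∈ Metric.ball (ψ p).fst ε := fun y hy => by
    rw [Metric.mem_ball, dist_eq_norm] at hy ⊢
    rw [← WithLp.sub_fst, ← map_sub]
    exact (WithLp.norm_fst_le (p := 2) (α := E (d - 1)) (β := ℝ) (ψ (y - p))).trans_lt (by rwa [ψ.norm_map])
  refine ⟨hmaps x hx, ?_⟩
  have hfst : Continuous fun y : E d => (ψ y).fst :=
    (WithLp.prod_continuous_ofLp 2 _ _).fst.comp ψ.continuous
  have hsnd : Continuous fun y : E d => (ψ y).snd :=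
    (WithLp.prod_continuous_ofLp 2 _ _).snd.comp ψ.continuous
  have hc1 : ContinuousAt (fun y => γ (ψ y).fst) x :=
    ContinuousAt.comp (f := fun y : E d => (ψ y).fst) (g := γ)
      (hγ.continuousAt (Metric.isOpen_ball.mem_nhds (hmaps x hx))) hfst.continuousAt
  have hball : ∀ᶠ y in 𝓝 x, y ∈ Metric.ball p ε := Metric.isOpen_ball.mem_nhds hx
  rcases lt_trichotomy (γ (ψ x).fst) (ψ x).snd with hlt | heq | hgt
  · exfalso
    have hev := hc1.eventually_lt hsnd.continuousAt hlt
    refine hf.2 (mem_interior_iff_mem_nhds.mpr ?_)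
    filter_upwards [hev, hball] with y h1 h2
    exact (h y h2).mpr h1
  · exact heq
  · exfalso
    have hev := hsnd.continuousAt.eventually_lt hc1 hgt
    obtain ⟨y, hy, hyΩ⟩ := mem_closure_iff_nhds.mp hf.1 _ (hev.and hball)
    exact absurd ((h y hy.2).mp hyΩ) (not_lt.mpr hy.1.le)

theorem euclideanHausdorffMeasure_lt_top {d n : ℕ} {s : Set (E d)}
    (h : Measure.hausdorffMeasure (n : ℝ) s < ⊤) :
    Measure.euclideanHausdorffMeasure n s < ⊤ := by
  rw [Measure.euclideanHausdorffMeasure, Measure.smul_apply]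
  exact ENNReal.mul_lt_top ENNReal.coe_lt_top h

theorem hausdorffMeasure_ball_lt_top {n : ℕ} (x : E n) (ε : ℝ) :
    Measure.hausdorffMeasure (n : ℝ) (Metric.ball x ε) < ⊤ := by
  have h : (Measure.hausdorffMeasure (Module.finrank ℝ (E n)) : Measure (E n)) (Metric.ball x ε) < ⊤ :=
    measure_ball_lt_top
  simpa using h

/-- The compact boundary is covered by finitely many patches, each inside a Lipschitz image of a
ball in `ℝ^(d-1)`. A Lipschitz map enlarges Hausdorff measure by at most a finite factor. -/
theorem isFiniteMeasure_surfaceMeasure {d : ℕ} {r : ℝ} (hr : 1 ≤ r) {Ω : Set (E d)}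
    (hb : Bornology.IsBounded Ω) (hΩ : BoundaryOfClass r Ω) :
    IsFiniteMeasure (surfaceMeasure Ω) := by
  have hcomp : IsCompact (frontier Ω) :=
    hb.isCompact_closure.of_isClosed_subset isClosed_frontier frontier_subset_closure
  refine ⟨?_⟩
  rw [surfaceMeasure, Measure.restrict_apply_univ]
  refine hcomp.induction_on (p := fun s =>
    (Measure.euclideanHausdorffMeasure (d - 1) : Measure (E d)) s < ⊤) (by simp)
    (fun s t hst ht => (measure_mono hst).trans_lt ht)
    (fun s t hs ht => measure_union_lt_top hs ht) fun p hp => ?_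
  obtain ⟨ε, hε, ψ, γ, hγ, h⟩ := hΩ p hp
  obtain ⟨K, hK⟩ := hγ.exists_lipschitzOnWith hr
  refine ⟨Metric.ball p ε ∩ frontier Ω, ?_, ?_⟩
  · rw [Set.inter_comm]
    exact inter_mem_nhdsWithin _ (Metric.ball_mem_nhds p hε)
  apply euclideanHausdorffMeasure_lt_top
  set B := Metric.ball (ψ p).fst ε
  set Γ : E (d - 1) → E d := fun y => ψ.symm (WithLp.toLp 2 (y, γ y)) with hΓ
  have hLip : ∃ K', LipschitzOnWith K' Γ B := by
    have h1 : LipschitzOnWith (max 1 K) (fun y => (y, γ y)) B :=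
      (LipschitzWith.id.lipschitzOnWith (s := B)).prodMk hK
    obtain ⟨C, hC⟩ : ∃ C, LipschitzWith C (WithLp.toLp 2 : E (d - 1) × ℝ → _) :=
      ⟨_, WithLp.prod_lipschitzWith_toLp 2 (E (d - 1)) ℝ⟩
    exact ⟨_, ψ.symm.lipschitz.comp_lipschitzOnWith (hC.comp_lipschitzOnWith h1)⟩
  obtain ⟨K', hK'⟩ := hLip
  have hsub : Metric.ball p ε ∩ frontier Ω ⊆ Γ '' B := by
    rintro x ⟨hx, hxf⟩
    obtain ⟨h1, h2⟩ := graph_of_mem_frontier hγ.continuousOn h hx hxf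
    refine ⟨(ψ x).fst, h1, ?_⟩
    rw [hΓ, LinearIsometryEquiv.symm_apply_eq]
    rw [h2]
    rfl
  refine (measure_mono hsub).trans_lt
    ((hK'.hausdorffMeasure_image_le (Nat.cast_nonneg _)).trans_lt ?_)
  exact ENNReal.mul_lt_top (ENNReal.rpow_lt_top_of_nonneg (Nat.cast_nonneg _) ENNReal.coe_ne_top)
    (hausdorffMeasure_ball_lt_top _ _)

theorem MemSobolevOn.memLp_trace {d : ℕ} {s : ℝ} (hs : (d : ℝ) < 2 * s) {Ω : Set (E d)}
    (hb : Bornology.IsBounded Ω) [IsFiniteMeasure (surfaceMeasure Ω)] {f : E d → ℝ}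
    (hf : MemSobolevOn s Ω f) : MemLp (trace Ω f) 2 (surfaceMeasure Ω) := by
  have hc := (hf.trace_spec hs).1
  obtain ⟨C, hC⟩ := hb.isCompact_closure.exists_bound_of_continuousOn hc
  have hm : MeasurableSet (frontier Ω) := isClosed_frontier.measurableSet
  refine MemLp.of_bound ?_ C ?_
  · exact (hc.mono frontier_subset_closure).aestronglyMeasurable hm
  · exact (ae_restrict_iff' hm).mpr (ae_of_all _ fun x hx => hC x (frontier_subset_closure hx))

/-! ### The differential operator on Sobolev functions -/

theorem MemSobolevOn.hasWeakPartial_weakPartial {d : ℕ} {s : ℝ} (hs : 2 ≤ s) {Ω : Set (E d)}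
    (hΩ : IsOpen Ω) {f : E d → ℝ} (hf : MemSobolevOn s Ω f) (i j : Fin d) :
    (∃ g, HasWeakPartial Ω i (LeastSquaresRBF.weakPartial Ω j f) g) ∧
      MemSobolevOn (s - 2) Ω (LeastSquaresRBF.weakPartial Ω i
        (LeastSquaresRBF.weakPartial Ω j f)) := by
  have h := (hf.weakPartial (by linarith) hΩ j).2.weakPartial (by linarith) hΩ i
  refine ⟨h.1, ?_⟩
  rw [show s - 2 = s - 1 - 1 by ring]
  exact h.2

theorem HolderClass.memLp_mul {d : ℕ} {q : ℝ} {Ω : Set (E d)} (hΩ : IsOpen Ω)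
    (hb : Bornology.IsBounded Ω) {a f : E d → ℝ} (ha : HolderClass q Ω a)
    (hf : MemLp f 2 (volume.restrict Ω)) :
    MemLp (fun x => a x * f x) 2 (volume.restrict Ω) := by
  obtain ⟨C, hC⟩ := ha.exists_bound hb
  have h : MemLp a ⊤ (volume.restrict Ω) := memLp_top_of_bound
    (ha.continuousOn.aestronglyMeasurable hΩ.measurableSet) C
    ((ae_restrict_iff' hΩ.measurableSet).mpr (ae_of_all _ hC))
  exact hf.mul h

theorem Operator.memLp_apply {d : ℕ} (L : Operator d) {s q : ℝ} (hs : 2 ≤ s) {Ω : Set (E d)}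
    (hΩ : IsOpen Ω) (hb : Bornology.IsBounded Ω) (hL : L.CoeffClass q Ω) {w : E d → ℝ}
    (hw : MemSobolevOn s Ω w) : MemLp (L.apply Ω w) 2 (volume.restrict Ω) := by
  have h2 : MemLp (fun x => ∑ i, ∑ j, L.a i j x * weakPartial Ω i (weakPartial Ω j w) x) 2
      (volume.restrict Ω) :=
    memLp_finsetSum _ fun i _ => memLp_finsetSum _ fun j _ =>
      (hL.1 i j).memLp_mul hΩ hb (hw.hasWeakPartial_weakPartial hs hΩ i j).2.memLp
  have h1 : MemLp (fun x => ∑ i, L.b i x * weakPartial Ω i w x) 2 (volume.restrict Ω) :=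
    memLp_finsetSum _ fun i _ =>
      (hL.2.1 i).memLp_mul hΩ hb (hw.weakPartial (by linarith) hΩ i).2.memLp
  exact (h2.neg.add h1).add (hL.2.2.memLp_mul hΩ hb hw.memLp)

theorem Operator.apply_add_ae {d : ℕ} (L : Operator d) {s : ℝ} (hs : 2 ≤ s) {Ω : Set (E d)}
    (hΩ : IsOpen Ω) {v w : E d → ℝ} (hv : MemSobolevOn s Ω v) (hw : MemSobolevOn s Ω w) :
    L.apply Ω (v + w) =ᵐ[volume.restrict Ω] L.apply Ω v + L.apply Ω w := by
  have h1 : ∀ i, LeastSquaresRBF.weakPartial Ω i (v + w) =ᵐ[volume.restrict Ω]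
      weakPartial Ω i v + weakPartial Ω i w := fun i =>
    weakPartial_add_ae hΩ (hv.weakPartial (by linarith) hΩ i).1
      (hw.weakPartial (by linarith) hΩ i).1
  have h2 : ∀ i j, weakPartial Ω i (weakPartial Ω j (v + w)) =ᵐ[volume.restrict Ω]
      weakPartial Ω i (weakPartial Ω j v) + weakPartial Ω i (weakPartial Ω j w) := fun i j =>
    -- The inner derivative is additive only almost everywhere, so it is replaced under the outer
    -- one before additivity is used again.
    (weakPartial_congr_ae hΩ ((hv.add hw).hasWeakPartial_weakPartial hs hΩ i j).1 (h1 j)).symm.trans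
      (weakPartial_add_ae hΩ (hv.hasWeakPartial_weakPartial hs hΩ i j).1
        (hw.hasWeakPartial_weakPartial hs hΩ i j).1)
  filter_upwards [ae_all_iff.mpr h1, ae_all_iff.mpr fun i => ae_all_iff.mpr (h2 i)] with x e1 e2
  simp only [Operator.apply, Pi.add_apply, e1, e2, mul_add, Finset.sum_add_distrib]
  ring

theorem Operator.apply_const_smul_ae {d : ℕ} (L : Operator d) {s : ℝ} (hs : 2 ≤ s) {Ω : Set (E d)}
    (hΩ : IsOpen Ω) {v : E d → ℝ} (hv : MemSobolevOn s Ω v) (c : ℝ) :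
    L.apply Ω (c • v) =ᵐ[volume.restrict Ω] c • L.apply Ω v := by
  have h1 : ∀ i, weakPartial Ω i (c • v) =ᵐ[volume.restrict Ω] c • weakPartial Ω i v := fun i =>
    weakPartial_const_smul_ae hΩ (hv.weakPartial (by linarith) hΩ i).1 c
  have h2 : ∀ i j, weakPartial Ω i (weakPartial Ω j (c • v)) =ᵐ[volume.restrict Ω]
      c • weakPartial Ω i (weakPartial Ω j v) := fun i j =>
    (weakPartial_congr_ae hΩ ((hv.const_smul c).hasWeakPartial_weakPartial hs hΩ i j).1
      (h1 j)).symm.trans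
      (weakPartial_const_smul_ae hΩ (hv.hasWeakPartial_weakPartial hs hΩ i j).1 c)
  filter_upwards [ae_all_iff.mpr h1, ae_all_iff.mpr fun i => ae_all_iff.mpr (h2 i)] with x e1 e2
  simp only [Operator.apply, Pi.smul_apply, smul_eq_mul, e1, e2, mul_left_comm _ c,
    ← Finset.mul_sum]
  ring

/-! ### The energy space -/

/-- The members of `H^s(Ω)`, as a space of functions. -/
def sobolevSpace {d : ℕ} (s : ℝ) (Ω : Set (E d)) : Submodule ℝ (E d → ℝ) where
  carrier := {f | MemSobolevOn s Ω f}
  add_mem' hf hg := MemSobolevOn.add hf hg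
  zero_mem' := MemSobolevOn.zero
  smul_mem' c _ hf := MemSobolevOn.const_smul hf c

/-- The operator `L` as a linear map from `H^s(Ω)` to `L²(Ω)`. -/
noncomputable def Operator.toL2 {d : ℕ} (L : Operator d) {s q : ℝ} (hs : 2 ≤ s) {Ω : Set (E d)}
    (hΩ : IsOpen Ω) (hb : Bornology.IsBounded Ω) (hL : L.CoeffClass q Ω) :
    sobolevSpace s Ω →ₗ[ℝ] Lp ℝ 2 (volume.restrict Ω) where
  toFun w := (L.memLp_apply hs hΩ hb hL w.2).toLp _
  map_add' v w := by
    rw [← MemLp.toLp_add]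
    exact MemLp.toLp_congr _ _ (L.apply_add_ae hs hΩ v.2 w.2)
  map_smul' c v := by
    rw [RingHom.id_apply, ← MemLp.toLp_const_smul]
    exact MemLp.toLp_congr _ _ (L.apply_const_smul_ae hs hΩ v.2 c)

theorem ae_surfaceMeasure_of_eqOn {d : ℕ} {Ω : Set (E d)} {f g : E d → ℝ}
    (h : Set.EqOn f g (closure Ω)) : f =ᵐ[surfaceMeasure Ω] g :=
  (ae_restrict_iff' isClosed_frontier.measurableSet).mpr
    (ae_of_all _ fun _ hx => h (frontier_subset_closure hx))

/-- The trace as a linear map from `H^s(Ω)` to `L²(∂Ω)`. -/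
noncomputable def traceL2 {d : ℕ} {s : ℝ} (hs : (d : ℝ) < 2 * s) {Ω : Set (E d)} (hΩ : IsOpen Ω)
    (hb : Bornology.IsBounded Ω) [IsFiniteMeasure (surfaceMeasure Ω)] :
    sobolevSpace s Ω →ₗ[ℝ] Lp ℝ 2 (surfaceMeasure Ω) where
  toFun w := (MemSobolevOn.memLp_trace hs hb w.2).toLp _
  map_add' v w := by
    rw [← MemLp.toLp_add]
    exact MemLp.toLp_congr _ _ (ae_surfaceMeasure_of_eqOn (trace_add_eqOn hs hΩ v.2 w.2))
  map_smul' c v := by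
    rw [RingHom.id_apply, ← MemLp.toLp_const_smul]
    exact MemLp.toLp_congr _ _ (ae_surfaceMeasure_of_eqOn (trace_const_smul_eqOn hs hΩ v.2 c))

/-- The map `w ↦ (L w, κ w|_∂Ω)` into `L²(Ω) × L²(∂Ω)`. -/
noncomputable def Operator.energyMap {d : ℕ} (L : Operator d) {s q : ℝ} (hs : 2 ≤ s) (hd : (d : ℝ) < 2 * s)
    {Ω : Set (E d)} (hΩ : IsOpen Ω) (hb : Bornology.IsBounded Ω) (hL : L.CoeffClass q Ω)
    [IsFiniteMeasure (surfaceMeasure Ω)] (κ : ℝ) :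
    sobolevSpace s Ω →ₗ[ℝ]
      WithLp 2 (Lp ℝ 2 (volume.restrict Ω) × Lp ℝ 2 (surfaceMeasure Ω)) :=
  (WithLp.linearEquiv 2 ℝ _).symm.toLinearMap ∘ₗ
    (L.toL2 hs hΩ hb hL).prod (κ • traceL2 hd hΩ hb)

theorem inner_toLp_eq_integral {α : Type*} [MeasurableSpace α] {μ : Measure α} {f g : α → ℝ}
    (hf : MemLp f 2 μ) (hg : MemLp g 2 μ) :
    inner ℝ (hf.toLp f) (hg.toLp g) = ∫ x, f x * g x ∂μ := by
  rw [L2.inner_def]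
  refine integral_congr_ae ?_
  filter_upwards [hf.coeFn_toLp, hg.coeFn_toLp] with x h1 h2
  rw [h1, h2, RCLike.inner_apply, conj_trivial, mul_comm]

theorem norm_toLp_sub_sq_eq_integral {α : Type*} [MeasurableSpace α] {μ : Measure α}
    {f g : α → ℝ} (hf : MemLp f 2 μ) (hg : MemLp g 2 μ) :
    ‖hf.toLp f - hg.toLp g‖ ^ 2 = ∫ x, (f x - g x) ^ 2 ∂μ := by
  rw [← MemLp.toLp_sub, ← real_inner_self_eq_norm_sq, inner_toLp_eq_integral]
  simp only [Pi.sub_apply, pow_two]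

/-! ### The energy form and the functional as Hilbert space quantities -/

section EnergyMap

variable {d : ℕ} (L : Operator d) {s q : ℝ} (hs : 2 ≤ s) (hd : (d : ℝ) < 2 * s)
  {Ω : Set (E d)} (hΩ : IsOpen Ω) (hb : Bornology.IsBounded Ω) (hL : L.CoeffClass q Ω)
  [IsFiniteMeasure (surfaceMeasure Ω)]

theorem Operator.inner_energyMap {h κ : ℝ} (hκ : κ ^ 2 = h ^ (-3 : ℤ)) (v w : sobolevSpace s Ω) :
    inner ℝ (L.energyMap hs hd hΩ hb hL κ v) (L.energyMap hs hd hΩ hb hL κ w) =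
      L.Q Ω h v w := by
  have e : inner ℝ (L.energyMap hs hd hΩ hb hL κ v) (L.energyMap hs hd hΩ hb hL κ w) =
      inner ℝ (L.toL2 hs hΩ hb hL v) (L.toL2 hs hΩ hb hL w) +
        inner ℝ (κ • traceL2 hd hΩ hb v) (κ • traceL2 hd hΩ hb w) := rfl
  rw [e, real_inner_smul_left, real_inner_smul_right, ← mul_assoc, ← pow_two, hκ, Operator.Q]
  congr 1
  · exact inner_toLp_eq_integral (L.memLp_apply hs hΩ hb hL v.2) (L.memLp_apply hs hΩ hb hL w.2)
  · exact congrArg _ (inner_toLp_eq_integral (MemSobolevOn.memLp_trace hd hb v.2)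
      (MemSobolevOn.memLp_trace hd hb w.2))

theorem Operator.energyNorm_eq {h κ : ℝ} (hκ : κ ^ 2 = h ^ (-3 : ℤ)) (v : sobolevSpace s Ω) :
    L.energyNorm Ω h v = ‖L.energyMap hs hd hΩ hb hL κ v‖ := by
  rw [Operator.energyNorm, ← L.inner_energyMap hs hd hΩ hb hL hκ, real_inner_self_eq_norm_sq,
    Real.sqrt_sq (norm_nonneg _)]

/-- The data are the image of the exact solution, which turns least squares into best approximation.
-/
theorem Operator.J_eq_norm_sub_sq {h κ : ℝ} (hκ : κ ^ 2 = h ^ (-3 : ℤ)) {f g : E d → ℝ}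
    (u v : sobolevSpace s Ω) (hu : L.IsSolution s Ω f g u) :
    L.J Ω h f g v =
      1 / 2 * ‖L.energyMap hs hd hΩ hb hL κ u - L.energyMap hs hd hΩ hb hL κ v‖ ^ 2 := by
  have e : ‖L.energyMap hs hd hΩ hb hL κ u - L.energyMap hs hd hΩ hb hL κ v‖ ^ 2 =
      ‖L.toL2 hs hΩ hb hL u - L.toL2 hs hΩ hb hL v‖ ^ 2 +
        ‖κ • traceL2 hd hΩ hb u - κ • traceL2 hd hΩ hb v‖ ^ 2 :=
    WithLp.prod_norm_sq_eq_of_L2 _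
  have e1 : ‖L.toL2 hs hΩ hb hL u - L.toL2 hs hΩ hb hL v‖ ^ 2 =
      ∫ x in Ω, (L.apply Ω v x - f x) ^ 2 := by
    refine (norm_toLp_sub_sq_eq_integral (L.memLp_apply hs hΩ hb hL u.2)
      (L.memLp_apply hs hΩ hb hL v.2)).trans (integral_congr_ae ?_)
    filter_upwards [hu.2.1] with x hx
    rw [hx]
    ring
  have e2 : ‖traceL2 hd hΩ hb u - traceL2 hd hΩ hb v‖ ^ 2 =
      ∫ x, (trace Ω v x - g x) ^ 2 ∂(surfaceMeasure Ω) := by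
    refine (norm_toLp_sub_sq_eq_integral (MemSobolevOn.memLp_trace hd hb u.2)
      (MemSobolevOn.memLp_trace hd hb v.2)).trans (integral_congr_ae ?_)
    filter_upwards [hu.2.2] with x hx
    rw [hx]
    ring
  rw [e, ← smul_sub, norm_smul, mul_pow, Real.norm_eq_abs, sq_abs, hκ, e1, e2, Operator.J]

theorem Operator.ae_eq_zero_of_energyMap_eq_zero {κ : ℝ} (hκ : κ ≠ 0) {v : sobolevSpace s Ω}
    (hv : L.energyMap hs hd hΩ hb hL κ v = 0) :
    L.apply Ω v =ᵐ[volume.restrict Ω] 0 ∧ trace Ω v =ᵐ[surfaceMeasure Ω] 0 := by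
  have h1 : L.toL2 hs hΩ hb hL v = 0 := congrArg WithLp.fst hv
  have h2 : κ • traceL2 hd hΩ hb v = 0 := congrArg WithLp.snd hv
  rw [smul_eq_zero_iff_right hκ] at h2
  have e1 := (L.memLp_apply hs hΩ hb hL v.2).coeFn_toLp
  have e2 := (MemSobolevOn.memLp_trace hd hb v.2).coeFn_toLp
  rw [show (L.memLp_apply hs hΩ hb hL v.2).toLp _ = 0 from h1] at e1
  rw [show (MemSobolevOn.memLp_trace hd hb v.2).toLp _ = 0 from h2] at e2
  exact ⟨e1.symm.trans (Lp.coeFn_zero ℝ 2 _), e2.symm.trans (Lp.coeFn_zero ℝ 2 _)⟩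

end EnergyMap

/-! ### Projection, positivity of the fill distance, and uniqueness -/

/-- The range of `T` is finite-dimensional, so the projection onto it exists even when `H` is
incomplete. Injectivity of `T` is not needed for existence. -/
theorem exists_orthogonal_residual {V H : Type*} [AddCommGroup V] [Module ℝ V]
    [FiniteDimensional ℝ V] [NormedAddCommGroup H] [InnerProductSpace ℝ H] (T : V →ₗ[ℝ] H)
    (x : H) : ∃ v₀, ∀ v, inner ℝ (x - T v₀) (T v) = 0 := by
  obtain ⟨v₀, hv₀⟩ := (LinearMap.range T).starProjection_apply_mem x
  refine ⟨v₀, fun v => ?_⟩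
  rw [hv₀]
  exact Submodule.starProjection_inner_eq_zero x _ (LinearMap.mem_range_self T v)

/-- A nonempty open set in positive dimension is infinite, so some point of `Ω` avoids `X`.
Boundedness matters because `sSup` of an unbounded set of reals is `0`. At `h = 0` the weight `h⁻³`
would be `0` and the boundary term would disappear. -/
theorem fillDistance_pos {d : ℕ} (hd : 1 ≤ d) {Ω : Set (E d)} (hΩ : IsOpen Ω)
    (hne : Ω.Nonempty) (hb : Bornology.IsBounded Ω) {X : Finset (E d)} (hX : X.Nonempty) :
    0 < fillDistance Ω X := by
  have : Nonempty (Fin d) := ⟨⟨0, hd⟩⟩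
  obtain ⟨x, hxΩ, hxX⟩ : ∃ x ∈ Ω, x ∉ (X : Set (E d)) := by
    by_contra! hcon
    exact (infinite_of_mem_nhds hne.some (hΩ.mem_nhds hne.some_mem))
      (X.finite_toSet.subset hcon)
  obtain ⟨p, hp⟩ := hX
  have hpos : 0 < Metric.infDist x (X : Set (E d)) :=
    (X.finite_toSet.isClosed.notMem_iff_infDist_pos ⟨p, hp⟩).mp hxX
  obtain ⟨R, hR⟩ := hb.subset_closedBall p
  refine hpos.trans_le (le_csSup ⟨R, ?_⟩ ⟨x, hxΩ, rfl⟩)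
  rintro _ ⟨y, hy, rfl⟩
  exact (Metric.infDist_le_dist_of_mem hp).trans (hR hy)

theorem memSobolevOn_of_mem_trialSpace {d : ℕ} {τ : ℝ} (hτ : (d : ℝ) < 2 * τ) {Φ : E d → ℝ}
    (hΦ : IsSobolevKernel τ Φ) (Ω : Set (E d)) {X : Finset (E d)} {v : E d → ℝ}
    (hv : v ∈ trialSpace Φ X) : MemSobolevOn τ Ω v := by
  have h : trialSpace Φ X ≤ sobolevSpace τ Ω := by
    refine Submodule.span_le.mpr ?_
    rintro _ ⟨p, -, rfl⟩
    exact hΦ.memSobolevOn_comp_sub hτ Ω p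
  exact h hv

/-- Converts uniqueness for the given data into uniqueness for the homogeneous problem. -/
theorem Operator.IsSolution.add_of_ae_eq_zero {d : ℕ} {L : Operator d} {s : ℝ} (hs : 2 ≤ s)
    (hd : (d : ℝ) < 2 * s) {Ω : Set (E d)} (hΩ : IsOpen Ω) {f g u v : E d → ℝ}
    (hu : L.IsSolution s Ω f g u) (hv : MemSobolevOn s Ω v)
    (h1 : L.apply Ω v =ᵐ[volume.restrict Ω] 0) (h2 : trace Ω v =ᵐ[surfaceMeasure Ω] 0) :
    L.IsSolution s Ω f g (u + v) := by
  refine ⟨hu.1.add hv, ?_, ?_⟩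
  · filter_upwards [L.apply_add_ae hs hΩ hu.1 hv, hu.2.1, h1] with x e1 e2 e3
    rw [e1, Pi.add_apply, e2, e3, Pi.zero_apply, add_zero]
  · filter_upwards [ae_surfaceMeasure_of_eqOn (trace_add_eqOn hd hΩ hu.1 hv), hu.2.2, h2]
      with x e1 e2 e3
    rw [e1, Pi.add_apply, e2, e3, Pi.zero_apply, add_zero]

end LeastSquaresRBF

open LeastSquaresRBF
theorem theorem5p3 (d : ℕ) (hd : 1 ≤ d) (q τ : ℝ) (hq : 0 ≤ q)
    (hqd : (d : ℝ) / 2 < q + 2) (hqτ : q + 2 ≤ τ)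
    (Ω : Set (E d)) (hΩo : IsOpen Ω) (hΩc : IsConnected Ω) (hΩb : Bornology.IsBounded Ω)
    (hΩr : BoundaryOfClass (q + 2) Ω)
    (L : Operator d) (hLe : L.UniformlyElliptic Ω) (hLq : L.CoeffClass q Ω)
    (Φ : E d → ℝ) (hΦ : IsSobolevKernel τ Φ)
    (X : Finset (E d)) (hX : X.Nonempty) (hXΩ : (X : Set (E d)) ⊆ Ω)
    (h : ℝ) (hh : h = fillDistance Ω X)
    (f g u : E d → ℝ) (hu : L.IsSolution (q + 2) Ω f g u)
    (huniq : ∀ w : E d → ℝ, L.IsSolution (q + 2) Ω f g w → w =ᵐ[volume.restrict Ω] u) :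
    -- the functional and the forms are well defined: all the `L²` norms are finite
    (∀ v ∈ trialSpace Φ X, MemSobolevOn τ Ω v) ∧
    (∀ w : E d → ℝ, MemSobolevOn (q + 2) Ω w →
      MemLp (L.apply Ω w) 2 (volume.restrict Ω) ∧ MemLp (trace Ω w) 2 (surfaceMeasure Ω)) ∧
    ∃ uh ∈ trialSpace Φ X,
      -- `uh` is the unique minimizer of the functional over the trial space
      (∀ v ∈ trialSpace Φ X, L.J Ω h f g uh ≤ L.J Ω h f g v) ∧
      (∀ w ∈ trialSpace Φ X, (∀ v ∈ trialSpace Φ X, L.J Ω h f g w ≤ L.J Ω h f g v) → w = uh) ∧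
      -- `uh` is the orthogonal projection of `u`
      (∀ v ∈ trialSpace Φ X, L.Q Ω h (u - uh) v = 0) ∧
      (⨅ v : trialSpace Φ X, L.energyNorm Ω h (u - (v : E d → ℝ))) = L.energyNorm Ω h (u - uh) := by
  have hs : 2 ≤ q + 2 := by linarith
  have hds : (d : ℝ) < 2 * (q + 2) := by linarith
  have hdτ : (d : ℝ) < 2 * τ := by linarith
  have := isFiniteMeasure_surfaceMeasure (by linarith) hΩb hΩr
  have hpos : 0 < h := hh ▸ fillDistance_pos hd hΩo hΩc.nonempty hΩb hX
  have hκ : Real.sqrt (h ^ (-3 : ℤ)) ^ 2 = h ^ (-3 : ℤ) := Real.sq_sqrt (by positivity)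
  have hκ0 : Real.sqrt (h ^ (-3 : ℤ)) ≠ 0 := by positivity
  set κ := Real.sqrt (h ^ (-3 : ℤ))
  have hsub : trialSpace Φ X ≤ sobolevSpace (q + 2) Ω := fun v hv =>
    (memSobolevOn_of_mem_trialSpace hdτ hΦ Ω hv).mono hqτ
  have : FiniteDimensional ℝ (trialSpace Φ X) :=
    FiniteDimensional.span_of_finite ℝ (X.finite_toSet.image _)
  set u' : sobolevSpace (q + 2) Ω := ⟨u, hu.1⟩ with hu'
  set T := L.energyMap hs hds hΩo hΩb hLq κ
  set T' := T ∘ₗ Submodule.inclusion hsub with hT'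
  have hJ : ∀ v : trialSpace Φ X, L.J Ω h f g v = 1 / 2 * ‖T u' - T' v‖ ^ 2 := fun v =>
    L.J_eq_norm_sub_sq hs hds hΩo hΩb hLq hκ u' (Submodule.inclusion hsub v) hu
  have hN : ∀ v : trialSpace Φ X, L.energyNorm Ω h (u - v) = ‖T u' - T' v‖ := fun v =>
    (L.energyNorm_eq hs hds hΩo hΩb hLq hκ (u' - Submodule.inclusion hsub v)).trans
      (by rw [map_sub]; rfl)
  -- The boundary value problem gives `v = 0` only a.e. on `Ω`. Continuity makes this pointwise on
  -- `Ω`, which contains the centres, and positive definiteness extends it to all of `ℝ^d`.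
  have hinj : ∀ v : trialSpace Φ X, T' v = 0 → v = 0 := by
    intro v hv
    obtain ⟨h1, h2⟩ := L.ae_eq_zero_of_energyMap_eq_zero hs hds hΩo hΩb hLq hκ0 hv
    have hsol := huniq _ (hu.add_of_ae_eq_zero hs hds hΩo (hsub v.2) h1 h2)
    have hae : (v : E d → ℝ) =ᵐ[volume.restrict Ω] 0 := by
      filter_upwards [hsol] with x hx
      simpa using hx
    have hzero := Measure.eqOn_open_of_ae_eq hae hΩo
      (continuous_of_mem_trialSpace hΦ.continuous v.2).continuousOn continuousOn_const
    exact Subtype.ext (hΦ.eq_zero_of_eqOn_centres hdτ v.2 fun p hp => hzero (hXΩ hp))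
  obtain ⟨uh, horth⟩ := exists_orthogonal_residual T' (T u')
  have hpyth : ∀ v, ‖T u' - T' v‖ ^ 2 = ‖T u' - T' uh‖ ^ 2 + ‖T' (uh - v)‖ ^ 2 := by
    intro v
    have e : T u' - T' v = (T u' - T' uh) + T' (uh - v) := by rw [map_sub]; abel
    rw [e, norm_add_sq_real, horth, mul_zero, add_zero]
  refine ⟨fun v hv => memSobolevOn_of_mem_trialSpace hdτ hΦ Ω hv,
    fun w hw => ⟨L.memLp_apply hs hΩo hΩb hLq hw, hw.memLp_trace hds hΩb⟩,
    uh, uh.2, fun v hv => ?_, fun w hw hmin => ?_, fun v hv => ?_, ?_⟩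
  · rw [hJ uh, hJ ⟨v, hv⟩, hpyth ⟨v, hv⟩]
    nlinarith [sq_nonneg ‖T' (uh - ⟨v, hv⟩)‖]
  -- Comparing a second minimizer with `uh` leaves no room for the Pythagorean excess `‖T' (uh -
  -- w)‖²`.
  · have hle := hmin uh uh.2
    rw [hJ uh, hJ ⟨w, hw⟩, hpyth ⟨w, hw⟩] at hle
    have h0 : T' (uh - ⟨w, hw⟩) = 0 := by
      rw [← norm_eq_zero, ← sq_eq_zero_iff]
      exact le_antisymm (by linarith) (sq_nonneg _)
    exact (congrArg Subtype.val (sub_eq_zero.mp (hinj _ h0))).symm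
  · have e := L.inner_energyMap hs hds hΩo hΩb hLq hκ (u' - Submodule.inclusion hsub uh)
      (Submodule.inclusion hsub ⟨v, hv⟩)
    rw [map_sub] at e
    exact e.symm.trans (horth ⟨v, hv⟩)
  -- The real infimum requires a lower bound; `0` serves, the energy norm being a square root.
  · refine le_antisymm (ciInf_le ⟨0, ?_⟩ uh) (le_ciInf fun v => ?_)
    · rintro _ ⟨v, rfl⟩
      exact Real.sqrt_nonneg _
    · rw [hN, hN, ← sq_le_sq₀ (norm_nonneg _) (norm_nonneg _), hpyth v]
      exact le_add_of_nonneg_right (sq_nonneg _)
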